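/- Let $c>0$ be a real number and let $F_c:L^2[-1,1]\to L^2[-1,1]$ be the operator $F_c[\varphi](x)=\int_{-1}^{1}\varphi(t)e^{icxt}\,dt$, with eigenvalues $\lambda_0,\lambda_1,\dots$ (repeated according to multiplicity) ordered so that $|\lambda_n|\ge|\lambda_{n+1}|$ for all $n\ge 0$. Let $n\ge 0$ be an integer and let $\psi_n$ be the $n$th prolate spheroidal wave function of band limit $c$, i.e. the real-valued function with $\int_{-1}^1\psi_n(t)^2\,dt=1$ and $\lambda_n\psi_n(x)=\int_{-1}^{1}\psi_n(t)e^{icxt}\,dt$ for all $-1\le x\le 1$ (determined up to sign). Let $P_k$ and $Q_k$ be the Legendre polynomials and the Legendre functions of the second kind on $(-1,1)$: $$P_0(t)=1,\quad P_1(t)=t,\quad Q_0(t)=\tfrac12\log\frac{1+t}{1-t},\quad Q_1(t)=\frac t2\log\frac{1+t}{1-t}-1,$$ where both sequences satisfy, for $k\ge1$, the recurrence $(k+1)y_{k+1}(t)=(2k+1)\,t\,y_k(t)-k\,y_{k-1}(t)$. Put $$\alpha_k^{(n)}=\Bigl(k+\tfrac12\Bigr)\int_{-1}^1\psi_n(x)P_k(x)\,dx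 .$$ Then the series $$\tilde\Phi_n(t)=\sum_{k=0}^\infty\alpha_k^{(n)}Q_k(t)$$ converges absolutely for every $-1<t<1$. Moreover, let $t_1<\dots<t_n$ be the roots of $\psi_n$ in $(-1,1)$ and let $$W_j=\int_{-1}^1\frac{\psi_n(s)}{\psi_n'(t_j)\,(s-t_j)}\,ds\qquad(j=1,\dots,n)$$ be the weights of the PSWF-based quadrature rule of order $n$. Then, for every $j=1,\dots,n$, $\psi_n$ is differentiable at $t_j$, the integrand defining $W_j$ is integrable over $[-1,1]$, and $$W_j=-\frac{2}{\psi_n'(t_j)}\sum_{k=0}^\infty\alpha_k^{(n)}Q_k(t_j)=-2\cdot\frac{\tilde\Phi_n(t_j)}{\psi_n'(t_j)} .$$ -/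

import Mathlib

open MeasureTheory Set

noncomputable section

namespace PSWF

/-- Lebesgue measure on `[-1, 1]`. -/
abbrev mu : Measure ℝ := volume.restrict (Icc (-1 : ℝ) 1)

/-- The complex Hilbert space `L²[-1, 1]`. -/
abbrev L2 : Type := Lp ℂ 2 mu

/-- `F_c[φ](x) = ∫_{-1}^{1} φ(t) e^{icxt} dt`. -/
def bandInt (c : ℝ) (φ : ℝ → ℂ) (x : ℝ) : ℂ :=
  ∫ t in (-1 : ℝ)..1, φ t * Complex.exp (Complex.I * c * x * t)

theorem bandInt_eq (c : ℝ) (φ : ℝ → ℂ) (x : ℝ) :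
    bandInt c φ x = ∫ t, φ t * Complex.exp (Complex.I * c * x * t) ∂mu := by
  rw [bandInt, intervalIntegral.integral_of_le (by norm_num), integral_Icc_eq_integral_Ioc]

theorem norm_kernel (c x t : ℝ) : ‖Complex.exp (Complex.I * c * x * t)‖ = 1 := by
  have : Complex.I * c * x * t = ((c * x * t : ℝ) : ℂ) * Complex.I := by push_cast; ring
  rw [this, Complex.norm_exp_ofReal_mul_I]

theorem integrable_L2 (φ : L2) : Integrable φ mu :=
  (Lp.memLp φ).integrable (by norm_num)

theorem integrable_kernel (c x : ℝ) (φ : L2) :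
    Integrable (fun t : ℝ => φ t * Complex.exp (Complex.I * c * x * t)) mu := by
  refine (integrable_L2 φ).mul_bdd (c := 1) ?_ ?_
  · exact (by fun_prop : Continuous fun t : ℝ =>
      Complex.exp (Complex.I * c * x * t)).aestronglyMeasurable
  · exact Filter.Eventually.of_forall fun t => (norm_kernel c x t).le

theorem continuous_bandInt (c : ℝ) (φ : L2) : Continuous (bandInt c φ) := by
  have h : bandInt c φ = fun x : ℝ => ∫ t, φ t * Complex.exp (Complex.I * c * x * t) ∂mu :=
    funext fun x => bandInt_eq c φ x
  rw [h]
  refine continuous_of_dominated (bound := fun t => ‖φ t‖)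
    (fun x => (integrable_kernel c x φ).aestronglyMeasurable) ?_ (integrable_L2 φ).norm ?_
  · intro x
    filter_upwards with t
    rw [norm_mul, norm_kernel, mul_one]
  · filter_upwards with t
    fun_prop

theorem memLp_bandInt (c : ℝ) (φ : L2) : MemLp (bandInt c φ) 2 mu := by
  refine MemLp.of_bound (continuous_bandInt c φ).aestronglyMeasurable (∫ t, ‖φ t‖ ∂mu) ?_
  filter_upwards with x
  rw [bandInt_eq]
  refine (norm_integral_le_integral_norm _).trans_eq ?_
  congr 1
  funext t
  rw [norm_mul, norm_kernel, mul_one]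

/-- The operator `F_c : L²[-1, 1] → L²[-1, 1]`. -/
def bandOp (c : ℝ) : Module.End ℂ L2 where
  toFun φ := (memLp_bandInt c φ).toLp (bandInt c φ)
  map_add' φ χ := by
    rw [← MemLp.toLp_add]
    congr 1
    funext x
    simp only [Pi.add_apply, bandInt_eq]
    rw [← integral_add (integrable_kernel c x φ) (integrable_kernel c x χ)]
    refine integral_congr_ae ?_
    filter_upwards [Lp.coeFn_add φ χ] with t ht
    rw [ht, Pi.add_apply, add_mul]
  map_smul' a φ := by
    rw [RingHom.id_apply, ← MemLp.toLp_const_smul]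
    congr 1
    funext x
    simp only [Pi.smul_apply, bandInt_eq]
    rw [← integral_smul]
    refine integral_congr_ae ?_
    filter_upwards [Lp.coeFn_smul a φ] with t ht
    rw [ht, Pi.smul_apply, smul_eq_mul, smul_eq_mul, mul_assoc]

/-- `ev 0, ev 1, …` lists the eigenvalues of `F_c`, each repeated according to its multiplicity,
in the order of non-increasing absolute value. -/
structure IsEigenvalueSeq (c : ℝ) (ev : ℕ → ℂ) : Prop where
  antitone : ∀ n, ‖ev (n + 1)‖ ≤ ‖ev n‖
  multiplicity : ∀ z : ℂ,
    Cardinal.mk {n : ℕ // ev n = z} = Module.rank ℂ (Module.End.eigenspace (bandOp c) z)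

/-- `ψ` is the `n`-th prolate spheroidal wave function of band limit `c`: a real eigenfunction of
`F_c` of unit norm in `L²[-1, 1]`, which belongs to the `n`-th eigenvalue. (Only the values of `ψ`
on `[-1, 1]` matter.) -/
structure IsPSWF (c : ℝ) (n : ℕ) (ψ : ℝ → ℝ) : Prop where
  memLp : MemLp ψ 2 mu
  norm_one : ∫ t in (-1 : ℝ)..1, ψ t ^ 2 = 1
  eigen : ∃ ev : ℕ → ℂ, IsEigenvalueSeq c ev ∧
    ∀ x ∈ Icc (-1 : ℝ) 1, ev n * (ψ x : ℂ) = bandInt c (fun t => (ψ t : ℂ)) x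

/-- The Legendre polynomials `P_k`. -/
def legendreP : ℕ → ℝ → ℝ
  | 0, _ => 1
  | 1, t => t
  | k + 2, t => ((2 * (k : ℝ) + 3) * t * legendreP (k + 1) t
      - ((k : ℝ) + 1) * legendreP k t) / ((k : ℝ) + 2)

/-- The Legendre functions of the second kind `Q_k` on `(-1, 1)`. -/
def legendreQ : ℕ → ℝ → ℝ
  | 0, t => 1 / 2 * Real.log ((1 + t) / (1 - t))
  | 1, t => t / 2 * Real.log ((1 + t) / (1 - t)) - 1
  | k + 2, t => ((2 * (k : ℝ) + 3) * t * legendreQ (k + 1) t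
      - ((k : ℝ) + 1) * legendreQ k t) / ((k : ℝ) + 2)

/-- The Legendre coefficients `α_k = (k + 1/2) ∫_{-1}^{1} ψ(x) P_k(x) dx`. -/
def legendreCoeff (ψ : ℝ → ℝ) (k : ℕ) : ℝ :=
  ((k : ℝ) + 1 / 2) * ∫ x in (-1 : ℝ)..1, ψ x * legendreP k x

/-- `Φ̃(t) = ∑_k α_k Q_k(t)`. -/
def tildePhi (ψ : ℝ → ℝ) (t : ℝ) : ℝ :=
  ∑' k : ℕ, legendreCoeff ψ k * legendreQ k t

/-- The function `s ↦ ψ(s) / (ψ'(τ) (s - τ))` attached to a node `τ`; its value at the single point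
`s = τ` has no effect on its integral. -/
def cardinalFun (ψ : ℝ → ℝ) (τ s : ℝ) : ℝ :=
  ψ s / (deriv ψ τ * (s - τ))

/-- `(t_1, …, t_n, W_1, …, W_n)` is the PSWF-based quadrature rule of order `n`: the nodes are the
roots of `ψ` in `(-1, 1)` in increasing order, and `W_j` is the integral of the function attached
to `t_j`. -/
structure IsQuadratureRule (n : ℕ) (ψ : ℝ → ℝ) (t W : Fin n → ℝ) : Prop where
  strictMono : StrictMono t
  nodes : Set.range t = {x : ℝ | x ∈ Ioo (-1 : ℝ) 1 ∧ ψ x = 0}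
  weights : ∀ j, W j = ∫ s in (-1 : ℝ)..1, cardinalFun ψ (t j) s

end PSWF

end

noncomputable section

namespace PSWF

/-! The operator `F_c` is injective, because the Taylor coefficients of `F_c[ψ]` at `0` are nonzero
multiples of the moments of `ψ`. Hence `λ_n ≠ 0`, and the eigenvalue equation exhibits `ψ` on `[-1,
1]` as a power series with coefficients `O(|c|^m / m!)` (`IsPSWF.exists_hasSum`). Orthogonality of
`P_k` to lower powers then makes `α_k` decay geometrically, fast enough to absorb every crude
exponential bound used below, and `ψ = ∑ α_k P_k` on `[-1, 1]`.

Let `S_k(s) = (P_k(s) - P_k(τ)) / (s - τ)`, a polynomial in `s`. Its integral obeys the Legendre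
recurrence, which gives `∫ S_k = P_k(τ) L - 2 Q_k(τ)` with `L = log ((1 + τ) / (1 - τ))`
(`integral_legendreSlope`). Summing against `α_k` proves convergence of `∑ α_k Q_k(τ)`. If `ψ(τ) =
0`, then `ψ(s) = (s - τ) q(s)` with `q = ∑ α_k S_k` continuous, the logarithmic term drops out, and
`∫ q = -2 ∑ α_k Q_k(τ)`. Dividing by `ψ'(τ)` gives the weight. -/

/-! ### Legendre polynomials: recurrence, derivatives, orthogonality, a crude bound -/

theorem legendreP_zero (t : ℝ) : legendreP 0 t = 1 := by simp [legendreP]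

theorem legendreP_one (t : ℝ) : legendreP 1 t = t := by simp [legendreP]

theorem legendreP_rec (k : ℕ) (t : ℝ) :
    ((k : ℝ) + 2) * legendreP (k + 2) t =
      (2 * (k : ℝ) + 3) * t * legendreP (k + 1) t - ((k : ℝ) + 1) * legendreP k t := by
  have : (k : ℝ) + 2 ≠ 0 := by positivity
  rw [legendreP]
  field_simp

theorem mul_legendreP (k : ℕ) (t : ℝ) :
    t * legendreP (k + 1) t =
      (((k : ℝ) + 2) / (2 * k + 3)) * legendreP (k + 2) t +
        (((k : ℝ) + 1) / (2 * k + 3)) * legendreP k t := by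
  have : 2 * (k : ℝ) + 3 ≠ 0 := by positivity
  have := legendreP_rec k t
  field_simp
  linarith

theorem differentiable_legendreP (k : ℕ) : Differentiable ℝ (legendreP k) := by
  induction k using Nat.twoStepInduction with
  | zero => exact (funext legendreP_zero) ▸ differentiable_const _
  | one => exact (funext legendreP_one) ▸ differentiable_id
  | more k h0 h1 =>
    have : legendreP (k + 2) = fun t => ((2 * (k : ℝ) + 3) * t * legendreP (k + 1) t
      - ((k : ℝ) + 1) * legendreP k t) / ((k : ℝ) + 2) := funext fun t => by rw [legendreP]
    rw [this]
    fun_prop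

@[fun_prop]
theorem continuous_legendreP (k : ℕ) : Continuous (legendreP k) :=
  (differentiable_legendreP k).continuous

theorem deriv_legendreP_rec (k : ℕ) (t : ℝ) :
    ((k : ℝ) + 2) * deriv (legendreP (k + 2)) t =
      (2 * (k : ℝ) + 3) * (legendreP (k + 1) t + t * deriv (legendreP (k + 1)) t)
        - ((k : ℝ) + 1) * deriv (legendreP k) t := by
  have h2 := (differentiable_legendreP (k + 2) t).hasDerivAt.const_mul ((k : ℝ) + 2)
  have h1 := (((hasDerivAt_id t).const_mul (2 * (k : ℝ) + 3)).mul
    (differentiable_legendreP (k + 1) t).hasDerivAt).sub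
    ((differentiable_legendreP k t).hasDerivAt.const_mul ((k : ℝ) + 1))
  have h : (fun y => ((k : ℝ) + 2) * legendreP (k + 2) y) =
      (fun y => (2 * (k : ℝ) + 3) * id y) * legendreP (k + 1) -
        fun y => ((k : ℝ) + 1) * legendreP k y :=
    funext fun y => by simpa using legendreP_rec k y
  rw [h] at h2
  rw [h2.unique h1, id]
  ring

/-- The two first-order differential relations between consecutive Legendre polynomials. -/
theorem deriv_legendreP_relations (k : ℕ) (t : ℝ) :
    deriv (legendreP (k + 1)) t = t * deriv (legendreP k) t + ((k : ℝ) + 1) * legendreP k t ∧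
    t * deriv (legendreP (k + 1)) t - deriv (legendreP k) t =
      ((k : ℝ) + 1) * legendreP (k + 1) t := by
  induction k with
  | zero =>
    have h0 : deriv (legendreP 0) t = 0 := by
      rw [show legendreP 0 = fun _ => 1 from funext legendreP_zero, deriv_const]
    have h1 : deriv (legendreP 1) t = 1 := by
      rw [show legendreP 1 = id from funext legendreP_one, deriv_id]
    simp [h0, h1, legendreP_zero, legendreP_one]
  | succ k ih =>
    obtain ⟨hA, hB⟩ := ih
    have hk : (k : ℝ) + 2 ≠ 0 := by positivity
    have hA' : deriv (legendreP (k + 1 + 1)) t =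
        t * deriv (legendreP (k + 1)) t + ((k : ℝ) + 2) * legendreP (k + 1) t := by
      apply mul_left_cancel₀ hk
      -- The two relations need each other: the first at `k + 1` uses the second at `k`, and the
      -- second at `k + 1` uses both.
      linear_combination deriv_legendreP_rec k t + ((k : ℝ) + 1) * hB
    push_cast
    refine ⟨by linear_combination hA', ?_⟩
    linear_combination t * hA' + t * hB - hA - legendreP_rec k t

/-- Supplies an antiderivative of `P_{k+1}` that vanishes at both endpoints `±1`. -/
theorem deriv_legendreP_sub (k : ℕ) (t : ℝ) :
    deriv (legendreP (k + 2)) t - deriv (legendreP k) t = (2 * (k : ℝ) + 3) * legendreP (k + 1) t := by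
  have h1 := (deriv_legendreP_relations (k + 1) t).1
  have h2 := (deriv_legendreP_relations k t).2
  push_cast at h1
  linear_combination h1 + h2

theorem legendreP_at_one (k : ℕ) : legendreP k 1 = 1 := by
  induction k using Nat.twoStepInduction with
  | zero => exact legendreP_zero 1
  | one => exact legendreP_one 1
  | more k h0 h1 =>
    have hk : (k : ℝ) + 2 ≠ 0 := by positivity
    apply mul_left_cancel₀ hk
    rw [legendreP_rec, h0, h1]
    ring

theorem legendreP_at_neg_one (k : ℕ) : legendreP k (-1) = (-1) ^ k := by
  induction k using Nat.twoStepInduction with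
  | zero => simp [legendreP_zero]
  | one => simp [legendreP_one]
  | more k h0 h1 =>
    have hk : (k : ℝ) + 2 ≠ 0 := by positivity
    apply mul_left_cancel₀ hk
    rw [legendreP_rec, h0, h1]
    ring

theorem integral_legendreP_succ (k : ℕ) : ∫ t in (-1 : ℝ)..1, legendreP (k + 1) t = 0 := by
  have hk : 2 * (k : ℝ) + 3 ≠ 0 := by positivity
  have h := intervalIntegral.integral_eq_sub_of_hasDerivAt (a := -1) (b := 1)
    (f := fun t => legendreP (k + 2) t - legendreP k t)
    (f' := fun t => (2 * (k : ℝ) + 3) * legendreP (k + 1) t) (fun t _ => by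
      rw [← deriv_legendreP_sub]
      exact (differentiable_legendreP _ t).hasDerivAt.sub (differentiable_legendreP _ t).hasDerivAt)
    (Continuous.intervalIntegrable (by fun_prop) _ _)
  rw [intervalIntegral.integral_const_mul] at h
  simp only [legendreP_at_one, legendreP_at_neg_one] at h
  apply mul_left_cancel₀ hk
  rw [h]
  ring

/-- Integrating a function against `t P_{k+1}(t)` by means of the recurrence. -/
theorem integral_mul_legendreP {f : ℝ → ℝ} (hf : IntervalIntegrable f volume (-1) 1) (k : ℕ) :
    ∫ t in (-1 : ℝ)..1, f t * t * legendreP (k + 1) t =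
      (((k : ℝ) + 2) / (2 * k + 3)) * (∫ t in (-1 : ℝ)..1, f t * legendreP (k + 2) t) +
        (((k : ℝ) + 1) / (2 * k + 3)) * ∫ t in (-1 : ℝ)..1, f t * legendreP k t := by
  rw [← intervalIntegral.integral_const_mul, ← intervalIntegral.integral_const_mul,
    ← intervalIntegral.integral_add]
  · congr 1
    funext t
    rw [mul_assoc, mul_legendreP]
    ring
  · exact (hf.mul_continuousOn (continuous_legendreP _).continuousOn).const_mul _
  · exact (hf.mul_continuousOn (continuous_legendreP _).continuousOn).const_mul _

theorem integral_pow_mul_legendreP {m k : ℕ} (h : m < k) :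
    ∫ t in (-1 : ℝ)..1, t ^ m * legendreP k t = 0 := by
  induction m generalizing k with
  | zero =>
    obtain ⟨k, rfl⟩ := Nat.exists_eq_succ_of_ne_zero h.ne'
    simpa using integral_legendreP_succ k
  | succ m ih =>
    obtain ⟨k, rfl⟩ : ∃ l, k = l + 1 := ⟨k - 1, by omega⟩
    have := integral_mul_legendreP ((continuous_pow m).intervalIntegrable (-1) 1) k
    rw [ih (by omega), ih (by omega)] at this
    simpa [pow_succ] using this

theorem integral_legendreP_mul_of_lt {i j : ℕ} (h : i < j) :
    ∫ t in (-1 : ℝ)..1, legendreP i t * legendreP j t = 0 := by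
  induction i using Nat.twoStepInduction generalizing j with
  | zero =>
    simpa [legendreP_zero] using integral_pow_mul_legendreP h
  | one =>
    simpa [legendreP_one] using integral_pow_mul_legendreP h
  | more i h0 h1 =>
    obtain ⟨j, rfl⟩ : ∃ l, j = l + 1 := ⟨j - 1, by omega⟩
    have e : ∀ t, legendreP (i + 2) t * legendreP (j + 1) t =
        ((2 * (i : ℝ) + 3) / (i + 2)) * (legendreP (i + 1) t * t * legendreP (j + 1) t) -
          (((i : ℝ) + 1) / (i + 2)) * (legendreP i t * legendreP (j + 1) t) := fun t => by
      have hk : (i : ℝ) + 2 ≠ 0 := by positivity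
      have := legendreP_rec i t
      field_simp
      linear_combination legendreP (j + 1) t * this
    simp_rw [e]
    rw [intervalIntegral.integral_sub
      (Continuous.intervalIntegrable (by fun_prop) _ _)
      (Continuous.intervalIntegrable (by fun_prop) _ _),
      intervalIntegral.integral_const_mul, intervalIntegral.integral_const_mul,
      integral_mul_legendreP ((continuous_legendreP _).intervalIntegrable _ _),
      h1 (by omega), h1 (by omega), h0 (by omega)]
    ring

theorem integral_legendreP_mul_of_ne {i j : ℕ} (h : i ≠ j) :
    ∫ t in (-1 : ℝ)..1, legendreP i t * legendreP j t = 0 := by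
  rcases h.lt_or_gt with h | h
  · exact integral_legendreP_mul_of_lt h
  · simp_rw [mul_comm (legendreP i _)]
    exact integral_legendreP_mul_of_lt h

/-- Evaluate `∫ t P_{k+1} P_{k+2}` twice, applying the recurrence to `t P_{k+1}` and then to `t
P_{k+2}`; orthogonality leaves one squared norm on each side. -/
theorem integral_legendreP_sq (k : ℕ) :
    ∫ t in (-1 : ℝ)..1, legendreP k t * legendreP k t = 2 / (2 * k + 1) := by
  induction k using Nat.twoStepInduction with
  | zero => simp [legendreP_zero]; norm_num
  | one =>
    simp only [legendreP_one, ← pow_two]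
    rw [integral_pow]
    norm_num
  | more k h0 h1 =>
    have e1 := integral_mul_legendreP ((continuous_legendreP (k + 2)).intervalIntegrable (-1) 1) k
    have e2 := integral_mul_legendreP
      ((continuous_legendreP (k + 1)).intervalIntegrable (-1) 1) (k + 1)
    rw [integral_legendreP_mul_of_ne (by omega : k + 2 ≠ k)] at e1
    rw [integral_legendreP_mul_of_ne (by omega : k + 1 ≠ k + 1 + 2), h1] at e2
    have e : ∫ t in (-1 : ℝ)..1, legendreP (k + 2) t * t * legendreP (k + 1) t =
        ∫ t in (-1 : ℝ)..1, legendreP (k + 1) t * t * legendreP (k + 1 + 1) t := by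
      congr 1; funext t; ring
    rw [e, e2] at e1
    push_cast at e1 ⊢
    have h3 : 2 * (k : ℝ) + 3 ≠ 0 := by positivity
    have h5 : 2 * (k : ℝ) + 5 ≠ 0 := by positivity
    have h2 : (k : ℝ) + 2 ≠ 0 := by positivity
    have h5' : 2 * ((k : ℝ) + 1) + 3 ≠ 0 := by positivity
    have h5'' : 2 * ((k : ℝ) + 2) + 1 ≠ 0 := by positivity
    have h3' : 2 * ((k : ℝ) + 1) + 1 ≠ 0 := by positivity
    apply mul_left_cancel₀ (div_ne_zero h2 h3)
    simp only [mul_zero, add_zero, zero_add] at e1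
    rw [← e1]
    field_simp
    ring

/-- Far from the sharp bound `1`, but immediate from the recurrence and sufficient against the decay
of the coefficients. -/
theorem abs_legendreP_le (k : ℕ) {t : ℝ} (ht : |t| ≤ 1) : |legendreP k t| ≤ 3 ^ k := by
  induction k using Nat.twoStepInduction with
  | zero => simp [legendreP_zero]
  | one => rw [legendreP_one]; linarith
  | more k h0 h1 =>
    have hk : 0 < (k : ℝ) + 2 := by positivity
    have h := legendreP_rec k t
    refine le_of_mul_le_mul_left ?_ hk
    rw [← abs_of_pos hk, ← abs_mul, h, abs_of_pos hk]
    refine (abs_sub _ _).trans ?_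
    rw [abs_mul, abs_mul, abs_mul, abs_of_pos (by positivity : 0 < 2 * (k : ℝ) + 3),
      abs_of_pos (by positivity : 0 < (k : ℝ) + 1)]
    have : |t| * |legendreP (k + 1) t| ≤ 3 ^ (k + 1) := by
      nlinarith [abs_nonneg t, abs_nonneg (legendreP (k + 1) t)]
    calc (2 * (k : ℝ) + 3) * |t| * |legendreP (k + 1) t| + (k + 1) * |legendreP k t|
        ≤ (2 * (k : ℝ) + 3) * 3 ^ (k + 1) + (k + 1) * 3 ^ k := by
          rw [mul_assoc]; gcongr
      _ ≤ (k + 2) * 3 ^ (k + 2) := by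
          have : (0 : ℝ) ≤ 3 ^ k := by positivity
          have : (0 : ℝ) ≤ k * 3 ^ k := by positivity
          ring_nf
          linarith

/-! ### Completeness: moments determine an integrable function -/

/-- By the recurrence, multiplication by `t` preserves orthogonality to all Legendre polynomials. -/
theorem integral_pow_mul_mul_legendreP_eq_zero {f : ℝ → ℝ}
    (hf : IntervalIntegrable f volume (-1) 1)
    (h : ∀ k, ∫ t in (-1 : ℝ)..1, f t * legendreP k t = 0) (m k : ℕ) :
    ∫ t in (-1 : ℝ)..1, f t * t ^ m * legendreP k t = 0 := by
  induction m generalizing k with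
  | zero => simpa using h k
  | succ m ih =>
    cases k with
    | zero => simpa [legendreP_zero, legendreP_one, pow_succ, mul_assoc] using ih 1
    | succ k =>
      have := integral_mul_legendreP (hf.mul_continuousOn (continuous_pow m).continuousOn) k
      rw [ih, ih] at this
      simpa [pow_succ, mul_assoc] using this

theorem integral_mul_pow_eq_zero {f : ℝ → ℝ} (hf : IntervalIntegrable f volume (-1) 1)
    (h : ∀ k, ∫ t in (-1 : ℝ)..1, f t * legendreP k t = 0) (m : ℕ) :
    ∫ t in (-1 : ℝ)..1, f t * t ^ m = 0 := by
  simpa [legendreP_zero] using integral_pow_mul_mul_legendreP_eq_zero hf h m 0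

theorem intervalIntegral_eq_mu {E : Type*} [NormedAddCommGroup E] [NormedSpace ℝ E] (f : ℝ → E) :
    ∫ t in (-1 : ℝ)..1, f t = ∫ t, f t ∂mu := by
  rw [intervalIntegral.integral_of_le (by norm_num), integral_Icc_eq_integral_Ioc]

theorem intervalIntegrable_iff_mu {E : Type*} [NormedAddCommGroup E] {f : ℝ → E} :
    IntervalIntegrable f volume (-1) 1 ↔ Integrable f mu := by
  rw [intervalIntegrable_iff_integrableOn_Icc_of_le (by norm_num)]
  rfl

theorem integral_mul_polynomial_eq_zero {f : ℝ → ℝ} (hf : IntervalIntegrable f volume (-1) 1)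
    (h : ∀ m : ℕ, ∫ t in (-1 : ℝ)..1, f t * t ^ m = 0) (p : Polynomial ℝ) :
    ∫ t in (-1 : ℝ)..1, f t * p.eval t = 0 := by
  induction p using Polynomial.induction_on' with
  | add p q hp hq =>
    simp_rw [Polynomial.eval_add, mul_add]
    rw [intervalIntegral.integral_add, hp, hq, add_zero]
    · exact hf.mul_continuousOn p.continuous.continuousOn
    · exact hf.mul_continuousOn q.continuous.continuousOn
  | monomial m a =>
    simp_rw [Polynomial.eval_monomial, mul_left_comm _ a]
    rw [intervalIntegral.integral_const_mul, h, mul_zero]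

theorem integral_mul_continuous_eq_zero {f : ℝ → ℝ} (hf : IntervalIntegrable f volume (-1) 1)
    (h : ∀ m : ℕ, ∫ t in (-1 : ℝ)..1, f t * t ^ m = 0) {g : ℝ → ℝ} (hg : Continuous g) :
    ∫ t in (-1 : ℝ)..1, f t * g t = 0 := by
  set M := ∫ t in (-1 : ℝ)..1, |f t| with hM
  have hM0 : 0 ≤ M := intervalIntegral.integral_nonneg (by norm_num) fun t _ => abs_nonneg _
  refine abs_eq_zero.mp (le_antisymm (le_of_forall_pos_le_add fun ε hε => ?_) (abs_nonneg _))
  -- Weierstrass approximation; `M + 1` in place of `M` keeps the denominator positive.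
  obtain ⟨p, hp⟩ := exists_polynomial_near_of_continuousOn (-1) 1 g hg.continuousOn
    (ε / (M + 1)) (by positivity)
  have e : ∫ t in (-1 : ℝ)..1, f t * g t = ∫ t in (-1 : ℝ)..1, f t * (g t - p.eval t) := by
    simp_rw [mul_sub]
    rw [intervalIntegral.integral_sub (hf.mul_continuousOn hg.continuousOn)
      (hf.mul_continuousOn p.continuous.continuousOn), integral_mul_polynomial_eq_zero hf h,
      sub_zero]
  rw [e, zero_add]
  calc |∫ t in (-1 : ℝ)..1, f t * (g t - p.eval t)|
      ≤ ∫ t in (-1 : ℝ)..1, |f t * (g t - p.eval t)| :=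
        intervalIntegral.abs_integral_le_integral_abs (by norm_num)
    _ ≤ ∫ t in (-1 : ℝ)..1, |f t| * (ε / (M + 1)) := by
        refine intervalIntegral.integral_mono_on (by norm_num) ?_ ?_ fun t ht => ?_
        · exact (hf.mul_continuousOn (hg.sub p.continuous).continuousOn).abs
        · exact hf.abs.mul_const _
        · rw [abs_mul, abs_sub_comm]
          gcongr
          exact (hp t ht).le
    _ = M * (ε / (M + 1)) := by rw [intervalIntegral.integral_mul_const]
    _ ≤ ε := by
        rw [mul_div_assoc', div_le_iff₀ (by positivity)]
        nlinarith

/-- An integrable function on `[-1, 1]` all of whose moments vanish is zero almost everywhere. -/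
theorem ae_eq_zero_of_moments_eq_zero {f : ℝ → ℝ} (hf : IntervalIntegrable f volume (-1) 1)
    (h : ∀ m : ℕ, ∫ t in (-1 : ℝ)..1, f t * t ^ m = 0) : ∀ᵐ t ∂mu, f t = 0 := by
  refine ae_eq_zero_of_integral_contDiff_smul_eq_zero
    (intervalIntegrable_iff_mu.mp hf).locallyIntegrable fun g hg _ => ?_
  rw [← intervalIntegral_eq_mu, ← integral_mul_continuous_eq_zero hf h hg.continuous]
  congr 1
  funext t
  rw [smul_eq_mul, mul_comm]

/-! ### Injectivity of the operator and the power series of its eigenfunctions -/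

/-- The Taylor coefficients at `0` of `F_c[ψ]`. -/
def bandCoeff (c : ℝ) (ψ : ℝ → ℝ) (m : ℕ) : ℂ :=
  (Complex.I * c) ^ m / m.factorial * ((∫ t in (-1 : ℝ)..1, ψ t * t ^ m : ℝ) : ℂ)

theorem hasSum_bandInt (c : ℝ) {ψ : ℝ → ℝ} (hψ : IntervalIntegrable ψ volume (-1) 1) (x : ℝ) :
    HasSum (fun m => (x : ℂ) ^ m * bandCoeff c ψ m) (bandInt c (fun t => (ψ t : ℂ)) x) := by
  have hi := intervalIntegrable_iff_mu.mp hψ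
  have key := hasSum_integral_of_dominated_convergence (μ := mu)
    (F := fun m t => (ψ t : ℂ) * ((Complex.I * c * x * t) ^ m / m.factorial))
    (f := fun t => (ψ t : ℂ) * Complex.exp (Complex.I * c * x * t))
    (fun m t => |ψ t| * (|c * x| ^ m / m.factorial)) ?_ ?_ ?_ ?_ ?_
  · rw [bandInt_eq]
    have e : ∀ m, (x : ℂ) ^ m * bandCoeff c ψ m =
        ∫ t, (ψ t : ℂ) * ((Complex.I * c * x * t) ^ m / m.factorial) ∂mu := fun m => by
      rw [bandCoeff, ← intervalIntegral_eq_mu, ← intervalIntegral.integral_ofReal, ← mul_assoc,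
        ← intervalIntegral.integral_const_mul]
      congr 1
      funext t
      push_cast
      ring
    simp_rw [e]
    exact key
  · intro m
    exact (Complex.continuous_ofReal.comp_aestronglyMeasurable hi.aestronglyMeasurable).mul
      (by fun_prop : Continuous fun t : ℝ =>
        (Complex.I * c * x * t) ^ m / (m.factorial : ℂ)).aestronglyMeasurable
  · intro m
    filter_upwards [ae_restrict_mem measurableSet_Icc] with t ht
    have : ‖Complex.I * c * x * t‖ ≤ |c * x| := by
      simp only [norm_mul, Complex.norm_I, one_mul, Complex.norm_real, Real.norm_eq_abs, abs_mul]
      exact mul_le_of_le_one_right (by positivity) (abs_le.mpr ht)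
    rw [norm_mul, norm_div, norm_pow, Complex.norm_real, Real.norm_eq_abs, Complex.norm_natCast]
    gcongr
  · filter_upwards with t
    exact (Real.summable_pow_div_factorial _).mul_left _
  · simp_rw [tsum_mul_left]
    exact hi.abs.mul_const _
  · filter_upwards with t
    rw [Complex.exp_eq_exp_ℂ]
    exact (NormedSpace.expSeries_div_hasSum_exp (Complex.I * c * x * t)).mul_left _

theorem norm_bandCoeff_le (c : ℝ) {ψ : ℝ → ℝ} (hψ : IntervalIntegrable ψ volume (-1) 1) (m : ℕ) :
    ‖bandCoeff c ψ m‖ ≤ |c| ^ m / m.factorial * ∫ t in (-1 : ℝ)..1, |ψ t| := by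
  rw [bandCoeff, norm_mul, norm_div, norm_pow, norm_mul, Complex.norm_I, one_mul,
    Complex.norm_natCast, Complex.norm_real, Complex.norm_real, Real.norm_eq_abs, Real.norm_eq_abs]
  gcongr
  refine (intervalIntegral.abs_integral_le_integral_abs (by norm_num)).trans ?_
  refine intervalIntegral.integral_mono_on (by norm_num)
    (hψ.mul_continuousOn (continuous_pow m).continuousOn).abs hψ.abs fun t ht => ?_
  rw [abs_mul, abs_pow]
  exact mul_le_of_le_one_right (abs_nonneg _) (pow_le_one₀ (abs_nonneg _) (abs_le.mpr ht))

/-- The operator `F_c` is injective. -/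
theorem ae_eq_zero_of_bandInt_eq_zero {c : ℝ} (hc : c ≠ 0) {ψ : ℝ → ℝ}
    (hψ : IntervalIntegrable ψ volume (-1) 1)
    (h : ∀ x ∈ Icc (-1 : ℝ) 1, bandInt c (fun t => (ψ t : ℂ)) x = 0) : ∀ᵐ t ∂mu, ψ t = 0 := by
  refine ae_eq_zero_of_moments_eq_zero hψ fun m => ?_
  let p : FormalMultilinearSeries ℝ ℝ ℂ := fun m =>
    ContinuousMultilinearMap.mkPiRing ℝ (Fin m) (bandCoeff c ψ m)
  -- The transform vanishes near `0`, so uniqueness of power series kills every coefficient, hence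
  -- every moment.
  have hp : HasFPowerSeriesAt (0 : ℝ → ℂ) p 0 := by
    refine hasFPowerSeriesAt_iff.mpr ?_
    filter_upwards [Icc_mem_nhds (by norm_num : (-1 : ℝ) < 0) one_pos] with x hx
    have := hasSum_bandInt c hψ x
    rw [h x hx] at this
    simpa [p, FormalMultilinearSeries.coeff] using this
  have h0 := congrArg (fun q => FormalMultilinearSeries.coeff q m) hp.eq_zero
  have h1 : bandCoeff c ψ m = 0 := by simpa [p, FormalMultilinearSeries.coeff] using h0
  rw [bandCoeff, mul_eq_zero] at h1
  rcases h1 with h1 | h1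
  · exact absurd h1 (div_ne_zero (pow_ne_zero _ (mul_ne_zero Complex.I_ne_zero
      (Complex.ofReal_ne_zero.mpr hc))) (Nat.cast_ne_zero.mpr m.factorial_ne_zero))
  · exact_mod_cast h1

theorem IsPSWF.intervalIntegrable {c : ℝ} {n : ℕ} {ψ : ℝ → ℝ} (h : IsPSWF c n ψ) :
    IntervalIntegrable ψ volume (-1) 1 :=
  intervalIntegrable_iff_mu.mpr (h.memLp.integrable (by norm_num))

/-- On `[-1, 1]` a prolate spheroidal wave function is the sum of a rapidly convergent power
series. -/
theorem IsPSWF.exists_hasSum {c : ℝ} (hc : c ≠ 0) {n : ℕ} {ψ : ℝ → ℝ} (h : IsPSWF c n ψ) :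
    ∃ a : ℕ → ℝ, (Summable fun m => |a m| * 100 ^ m) ∧
      ∀ x ∈ Icc (-1 : ℝ) 1, HasSum (fun m => a m * x ^ m) (ψ x) := by
  obtain ⟨ev, -, hev⟩ := h.eigen
  have hψ := h.intervalIntegrable
  have h0 : ev n ≠ 0 := fun h0 => by
    have hz := ae_eq_zero_of_bandInt_eq_zero hc hψ fun x hx => by rw [← hev x hx, h0, zero_mul]
    have h1 := h.norm_one
    rw [intervalIntegral_eq_mu, integral_eq_zero_of_ae] at h1
    · exact zero_ne_one h1
    · filter_upwards [hz] with t ht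
      simp [ht]
  refine ⟨fun m => ((ev n)⁻¹ * bandCoeff c ψ m).re, ?_, fun x hx => ?_⟩
  · refine Summable.of_nonneg_of_le (fun m => by positivity) (fun m => ?_)
      ((Real.summable_pow_div_factorial (|c| * 100)).mul_left
        (‖(ev n)⁻¹‖ * ∫ t in (-1 : ℝ)..1, |ψ t|))
    calc |((ev n)⁻¹ * bandCoeff c ψ m).re| * 100 ^ m
        ≤ ‖(ev n)⁻¹‖ * (|c| ^ m / m.factorial * ∫ t in (-1 : ℝ)..1, |ψ t|) * 100 ^ m := by
          gcongr
          refine (Complex.abs_re_le_norm _).trans ?_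
          rw [norm_mul]
          gcongr
          exact norm_bandCoeff_le c hψ m
      _ = _ := by rw [mul_pow]; ring
  · have := Complex.hasSum_re ((hasSum_bandInt c hψ x).mul_left (ev n)⁻¹)
    rw [← hev x hx, inv_mul_cancel_left₀ h0, Complex.ofReal_re] at this
    convert this using 2 with m
    rw [mul_left_comm, ← Complex.ofReal_pow, Complex.re_ofReal_mul, mul_comm]

/-! ### Decay of the Legendre coefficients and the Legendre expansion -/

theorem abs_integral_pow_mul_legendreP_le (m k : ℕ) :
    |∫ t in (-1 : ℝ)..1, t ^ m * legendreP k t| ≤ 2 * 3 ^ k := by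
  have := intervalIntegral.norm_integral_le_of_norm_le_const (a := -1) (b := 1)
    (f := fun t : ℝ => t ^ m * legendreP k t) (C := 3 ^ k) fun t ht => by
      have ht : |t| ≤ 1 := by
        rw [uIoc_of_le (by norm_num)] at ht
        exact abs_le.mpr ⟨ht.1.le, ht.2⟩
      rw [Real.norm_eq_abs, abs_mul, abs_pow, ← one_mul ((3 : ℝ) ^ k)]
      gcongr
      · exact pow_le_one₀ (abs_nonneg _) ht
      · exact abs_legendreP_le k ht
  rw [Real.norm_eq_abs] at this
  refine this.trans_eq ?_
  norm_num
  ring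

/-- The Legendre coefficients of an analytic function decay geometrically. -/
theorem abs_legendreCoeff_le {ψ : ℝ → ℝ} {a : ℕ → ℝ} (ha : Summable fun m => |a m| * 100 ^ m)
    (h : ∀ x ∈ Icc (-1 : ℝ) 1, HasSum (fun m => a m * x ^ m) (ψ x)) (k : ℕ) :
    |legendreCoeff ψ k| ≤ 2 * (∑' m, |a m| * 100 ^ m) * (6 / 100) ^ k := by
  set A := ∑' m, |a m| * 100 ^ m
  have ha' : Summable fun m => |a m| := by
    refine Summable.of_nonneg_of_le (fun m => abs_nonneg _) (fun m => ?_) ha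
    exact le_mul_of_one_le_right (abs_nonneg _) (one_le_pow₀ (by norm_num))
  have key := hasSum_integral_of_dominated_convergence (μ := mu)
    (F := fun m t => a m * (t ^ m * legendreP k t))
    (f := fun t => ψ t * legendreP k t)
    (fun m _ => |a m| * 3 ^ k) ?_ ?_ ?_ ?_ ?_
  · simp_rw [integral_const_mul, ← intervalIntegral_eq_mu] at key
    have hb : ∀ m, |a m * ∫ t in (-1 : ℝ)..1, t ^ m * legendreP k t| ≤
        |a m| * 100 ^ m * (2 * (3 / 100) ^ k) := fun m => by
      -- Powers below `k` contribute nothing; for `m ≥ k` the weight `100 ^ m ≥ 100 ^ k` yields the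
      -- factor `(3 / 100) ^ k`.
      rcases lt_or_ge m k with hm | hm
      · rw [integral_pow_mul_legendreP hm, mul_zero, abs_zero]
        positivity
      · rw [abs_mul, mul_assoc]
        gcongr
        refine (abs_integral_pow_mul_legendreP_le m k).trans ?_
        calc (2 : ℝ) * 3 ^ k = 100 ^ k * (2 * (3 / 100) ^ k) := by
              rw [div_pow]; field_simp
          _ ≤ _ := by gcongr; norm_num
    have h1 : |∫ t in (-1 : ℝ)..1, ψ t * legendreP k t| ≤ A * (2 * (3 / 100) ^ k) := by
      rw [← key.tsum_eq]
      rw [← Real.norm_eq_abs]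
      exact tsum_of_norm_bounded (ha.hasSum.mul_right _) hb
    -- The prefactor costs `2 ^ k`, turning `3 / 100` into `6 / 100`.
    have h2 : (k : ℝ) + 1 / 2 ≤ 2 ^ k := by
      have : (k : ℝ) + 1 ≤ 2 ^ k := by exact_mod_cast Nat.lt_two_pow_self (n := k)
      linarith
    rw [legendreCoeff, abs_mul, abs_of_pos (by positivity : 0 < (k : ℝ) + 1 / 2)]
    calc ((k : ℝ) + 1 / 2) * |∫ t in (-1 : ℝ)..1, ψ t * legendreP k t|
        ≤ 2 ^ k * (A * (2 * (3 / 100) ^ k)) := by gcongr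
      _ = 2 * A * (2 ^ k * (3 / 100) ^ k) := by ring
      _ = _ := by rw [← mul_pow]; norm_num
  · intro m
    exact Continuous.aestronglyMeasurable (by fun_prop)
  · intro m
    filter_upwards [ae_restrict_mem measurableSet_Icc] with t ht
    have ht := abs_le.mpr ht
    rw [Real.norm_eq_abs, abs_mul, abs_mul, abs_pow]
    gcongr
    exact (mul_le_of_le_one_left (abs_nonneg _) (pow_le_one₀ (abs_nonneg _) ht)).trans
      (abs_legendreP_le k ht)
  · filter_upwards with t
    exact ha'.mul_right _
  · exact integrable_const _
  · filter_upwards [ae_restrict_mem measurableSet_Icc] with t ht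
    simpa only [mul_assoc] using (h t ht).mul_right (legendreP k t)

theorem summable_abs_mul_three_pow {α : ℕ → ℝ} (hα : Summable fun k => |α k| * 9 ^ k) :
    Summable fun k => |α k| * 3 ^ k := by
  refine Summable.of_nonneg_of_le (fun k => by positivity) (fun k => ?_) hα
  gcongr
  norm_num

theorem abs_mul_legendreP_le (α : ℕ → ℝ) (k : ℕ) {x : ℝ} (hx : x ∈ Icc (-1 : ℝ) 1) :
    |α k * legendreP k x| ≤ |α k| * 3 ^ k := by
  rw [abs_mul]
  gcongr
  exact abs_legendreP_le k (abs_le.mpr hx)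

/-- The weight `9 ^ k` is the later bound on the difference quotients of `P_k`; `100` was chosen to
exceed `6 * 9 = 54`. -/
theorem summable_legendreCoeff {ψ : ℝ → ℝ} {a : ℕ → ℝ} (ha : Summable fun m => |a m| * 100 ^ m)
    (h : ∀ x ∈ Icc (-1 : ℝ) 1, HasSum (fun m => a m * x ^ m) (ψ x)) :
    Summable fun k => |legendreCoeff ψ k| * 9 ^ k := by
  refine Summable.of_nonneg_of_le (fun k => by positivity) (fun k => ?_)
    ((summable_geometric_of_lt_one (by norm_num : (0 : ℝ) ≤ 54 / 100) (by norm_num)).mul_left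
      (2 * ∑' m, |a m| * 100 ^ m))
  calc |legendreCoeff ψ k| * 9 ^ k
      ≤ 2 * (∑' m, |a m| * 100 ^ m) * (6 / 100) ^ k * 9 ^ k := by
        gcongr
        exact abs_legendreCoeff_le ha h k
    _ = _ := by rw [mul_assoc, ← mul_pow]; norm_num

theorem continuousOn_of_hasSum_pow {ψ : ℝ → ℝ} {a : ℕ → ℝ}
    (ha : Summable fun m => |a m| * 100 ^ m)
    (h : ∀ x ∈ Icc (-1 : ℝ) 1, HasSum (fun m => a m * x ^ m) (ψ x)) :
    ContinuousOn ψ (Icc (-1) 1) := by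
  refine (continuousOn_tsum (f := fun m x => a m * x ^ m) (fun m => ?_) ha
    fun m x hx => ?_).congr fun x hx => (h x hx).tsum_eq.symm
  · exact Continuous.continuousOn (by fun_prop)
  · rw [Real.norm_eq_abs, abs_mul, abs_pow]
    gcongr
    exact (abs_le.mpr hx).trans (by norm_num)

theorem continuousOn_tsum_legendreP {α : ℕ → ℝ} (hα : Summable fun k => |α k| * 9 ^ k) :
    ContinuousOn (fun x => ∑' k, α k * legendreP k x) (Icc (-1) 1) :=
  continuousOn_tsum (fun k => Continuous.continuousOn (by fun_prop))
    (summable_abs_mul_three_pow hα) fun k _ hx => abs_mul_legendreP_le α k hx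

theorem hasSum_legendreP {α : ℕ → ℝ} (hα : Summable fun k => |α k| * 9 ^ k) {x : ℝ}
    (hx : x ∈ Icc (-1 : ℝ) 1) :
    HasSum (fun k => α k * legendreP k x) (∑' k, α k * legendreP k x) :=
  (Summable.of_norm_bounded (summable_abs_mul_three_pow hα)
    fun k => abs_mul_legendreP_le α k hx).hasSum

theorem integral_tsum_legendreP_mul {α : ℕ → ℝ} (hα : Summable fun k => |α k| * 9 ^ k) (j : ℕ) :
    ∫ t in (-1 : ℝ)..1, (∑' k, α k * legendreP k t) * legendreP j t = α j * (2 / (2 * j + 1)) := by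
  have key := hasSum_integral_of_dominated_convergence (μ := mu)
    (F := fun k t => α k * (legendreP k t * legendreP j t))
    (f := fun t => (∑' k, α k * legendreP k t) * legendreP j t)
    (fun k _ => |α k| * 3 ^ k * 3 ^ j) ?_ ?_ ?_ ?_ ?_
  · simp_rw [integral_const_mul, ← intervalIntegral_eq_mu] at key
    refine key.unique ?_
    rw [← integral_legendreP_sq]
    refine hasSum_single j fun k hk => ?_
    rw [integral_legendreP_mul_of_ne hk, mul_zero]
  · intro k
    exact Continuous.aestronglyMeasurable (by fun_prop)
  · intro k
    filter_upwards [ae_restrict_mem measurableSet_Icc] with t ht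
    rw [← mul_assoc, norm_mul, Real.norm_eq_abs, Real.norm_eq_abs]
    gcongr
    · exact abs_mul_legendreP_le α k ht
    · exact abs_legendreP_le j (abs_le.mpr ht)
  · filter_upwards with t
    exact (summable_abs_mul_three_pow hα).mul_right _
  · exact integrable_const _
  · filter_upwards [ae_restrict_mem measurableSet_Icc] with t ht
    simpa only [mul_assoc] using (hasSum_legendreP hα ht).mul_right (legendreP j t)

/-- A rapidly convergent power series is the sum of its Legendre series on `[-1, 1]`. -/
theorem hasSum_legendreCoeff_mul_legendreP {ψ : ℝ → ℝ} {a : ℕ → ℝ}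
    (ha : Summable fun m => |a m| * 100 ^ m)
    (h : ∀ x ∈ Icc (-1 : ℝ) 1, HasSum (fun m => a m * x ^ m) (ψ x)) {x : ℝ}
    (hx : x ∈ Icc (-1 : ℝ) 1) : HasSum (fun k => legendreCoeff ψ k * legendreP k x) (ψ x) := by
  have hα := summable_legendreCoeff ha h
  have hψ := continuousOn_of_hasSum_pow ha h
  have hF := continuousOn_tsum_legendreP hα
  have hle : (-1 : ℝ) ≤ 1 := by norm_num
  have hiψ := hψ.intervalIntegrable_of_Icc (μ := volume) hle
  have hiF := hF.intervalIntegrable_of_Icc (μ := volume) hle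
  -- `ψ` and the sum of its Legendre series have the same Legendre coefficients, so they agree
  -- almost everywhere, and everywhere on `[-1, 1]` by continuity.
  have hz := ae_eq_zero_of_moments_eq_zero (hiψ.sub hiF)
    (integral_mul_pow_eq_zero (hiψ.sub hiF) fun j => by
      simp_rw [sub_mul]
      rw [intervalIntegral.integral_sub
        (hiψ.mul_continuousOn (continuous_legendreP j).continuousOn)
        (hiF.mul_continuousOn (continuous_legendreP j).continuousOn),
        integral_tsum_legendreP_mul hα, legendreCoeff]
      have : 2 * (j : ℝ) + 1 ≠ 0 := by positivity
      field_simp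
      ring)
  have heq := Measure.eqOn_Icc_of_ae_eq volume (by norm_num : (-1 : ℝ) ≠ 1)
    (hz.mono fun t ht => sub_eq_zero.mp ht) hψ hF
  rw [heq hx]
  exact hasSum_legendreP hα hx

/-! ### Difference quotients of Legendre polynomials and the functions `Q_k` -/

/-- The polynomial `(P_k(s) - P_k(τ)) / (s - τ)`. -/
def legendreSlope (τ : ℝ) : ℕ → ℝ → ℝ
  | 0, _ => 0
  | 1, _ => 1
  | k + 2, s => ((2 * (k : ℝ) + 3) * (s * legendreSlope τ (k + 1) s + legendreP (k + 1) τ)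
      - ((k : ℝ) + 1) * legendreSlope τ k s) / ((k : ℝ) + 2)

theorem legendreSlope_rec (τ : ℝ) (k : ℕ) (s : ℝ) :
    ((k : ℝ) + 2) * legendreSlope τ (k + 2) s =
      (2 * (k : ℝ) + 3) * (s * legendreSlope τ (k + 1) s + legendreP (k + 1) τ)
        - ((k : ℝ) + 1) * legendreSlope τ k s := by
  have : (k : ℝ) + 2 ≠ 0 := by positivity
  rw [legendreSlope]
  field_simp

@[fun_prop]
theorem continuous_legendreSlope (τ : ℝ) (k : ℕ) : Continuous (legendreSlope τ k) := by
  induction k using Nat.twoStepInduction with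
  | zero =>
    exact (funext fun s => by rw [legendreSlope] : legendreSlope τ 0 = fun _ => 0) ▸
      continuous_const
  | one =>
    exact (funext fun s => by rw [legendreSlope] : legendreSlope τ 1 = fun _ => 1) ▸
      continuous_const
  | more k h0 h1 =>
    have : legendreSlope τ (k + 2) = fun s =>
      ((2 * (k : ℝ) + 3) * (s * legendreSlope τ (k + 1) s + legendreP (k + 1) τ)
        - ((k : ℝ) + 1) * legendreSlope τ k s) / ((k : ℝ) + 2) :=
      funext fun s => by rw [legendreSlope]
    rw [this]
    fun_prop

theorem sub_mul_legendreSlope (τ : ℝ) (k : ℕ) (s : ℝ) :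
    (s - τ) * legendreSlope τ k s = legendreP k s - legendreP k τ := by
  induction k using Nat.twoStepInduction with
  | zero => simp [legendreSlope, legendreP_zero]
  | one => simp [legendreSlope, legendreP_one]
  | more k h0 h1 =>
    have hk : (k : ℝ) + 2 ≠ 0 := by positivity
    apply mul_left_cancel₀ hk
    linear_combination (s - τ) * legendreSlope_rec τ k s - legendreP_rec k s + legendreP_rec k τ
      + (2 * (k : ℝ) + 3) * s * h1 - ((k : ℝ) + 1) * h0

theorem abs_legendreSlope_le {τ : ℝ} (hτ : |τ| ≤ 1) (k : ℕ) {s : ℝ} (hs : |s| ≤ 1) :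
    |legendreSlope τ k s| ≤ 9 ^ k := by
  induction k using Nat.twoStepInduction with
  | zero => simp [legendreSlope]
  | one => simp [legendreSlope]
  | more k h0 h1 =>
    have hk : 0 < (k : ℝ) + 2 := by positivity
    refine le_of_mul_le_mul_left ?_ hk
    rw [← abs_of_pos hk, ← abs_mul, legendreSlope_rec, abs_of_pos hk]
    have h2 : |s * legendreSlope τ (k + 1) s + legendreP (k + 1) τ| ≤ 12 * 9 ^ k := by
      refine (abs_add_le _ _).trans ?_
      have e1 : |s * legendreSlope τ (k + 1) s| ≤ 9 ^ (k + 1) := by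
        rw [abs_mul]
        exact (mul_le_of_le_one_left (abs_nonneg _) hs).trans h1
      have e2 := abs_legendreP_le (k + 1) hτ
      have e3 : (3 : ℝ) ^ k ≤ 9 ^ k := by gcongr; norm_num
      rw [pow_succ] at e1 e2
      linarith
    refine (abs_sub _ _).trans ?_
    rw [abs_mul, abs_mul, abs_of_pos (by positivity : 0 < 2 * (k : ℝ) + 3),
      abs_of_pos (by positivity : 0 < (k : ℝ) + 1)]
    calc (2 * (k : ℝ) + 3) * |s * legendreSlope τ (k + 1) s + legendreP (k + 1) τ|
          + (k + 1) * |legendreSlope τ k s|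
        ≤ (2 * (k : ℝ) + 3) * (12 * 9 ^ k) + (k + 1) * 9 ^ k := by gcongr
      _ ≤ (k + 2) * 9 ^ (k + 2) := by
          have : (0 : ℝ) ≤ 9 ^ k := by positivity
          have : (0 : ℝ) ≤ k * 9 ^ k := by positivity
          ring_nf
          linarith

/-- Neumann's formula `Q_k(τ) = ½ PV ∫ P_k(s) / (τ - s) ds`, with the principal value evaluated by
subtracting the singularity. -/
theorem integral_legendreSlope (τ : ℝ) (k : ℕ) :
    ∫ s in (-1 : ℝ)..1, legendreSlope τ k s =
      legendreP k τ * Real.log ((1 + τ) / (1 - τ)) - 2 * legendreQ k τ := by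
  induction k using Nat.twoStepInduction with
  | zero => simp [legendreSlope, legendreP_zero, legendreQ]
  | one =>
    simp only [legendreSlope, legendreP_one, legendreQ, intervalIntegral.integral_const]
    norm_num
    ring
  | more k h0 h1 =>
    have hk : (k : ℝ) + 2 ≠ 0 := by positivity
    -- Trading `s` for `τ` turns `P_{k+1}(τ)` into `P_{k+1}(s)`, whose integral is zero, so the
    -- integrals satisfy the homogeneous recurrence. The logarithm acts as a formal constant, so `τ`
    -- may be any real number.
    have e1 : ∫ s in (-1 : ℝ)..1, (s * legendreSlope τ (k + 1) s + legendreP (k + 1) τ) =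
        τ * ∫ s in (-1 : ℝ)..1, legendreSlope τ (k + 1) s := by
      have : ∀ s, s * legendreSlope τ (k + 1) s + legendreP (k + 1) τ =
          τ * legendreSlope τ (k + 1) s + legendreP (k + 1) s := fun s => by
        linear_combination sub_mul_legendreSlope τ (k + 1) s
      simp_rw [this]
      rw [intervalIntegral.integral_add (Continuous.intervalIntegrable (by fun_prop) _ _)
        (Continuous.intervalIntegrable (by fun_prop) _ _), integral_legendreP_succ,
        intervalIntegral.integral_const_mul, add_zero]
    have e2 : ((k : ℝ) + 2) * ∫ s in (-1 : ℝ)..1, legendreSlope τ (k + 2) s =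
        (2 * (k : ℝ) + 3) * (τ * ∫ s in (-1 : ℝ)..1, legendreSlope τ (k + 1) s)
          - ((k : ℝ) + 1) * ∫ s in (-1 : ℝ)..1, legendreSlope τ k s := by
      rw [← e1, ← intervalIntegral.integral_const_mul, ← intervalIntegral.integral_const_mul,
        ← intervalIntegral.integral_const_mul, ← intervalIntegral.integral_sub
        (Continuous.intervalIntegrable (by fun_prop) _ _)
        (Continuous.intervalIntegrable (by fun_prop) _ _)]
      simp_rw [legendreSlope_rec]
    have e3 : ((k : ℝ) + 2) * legendreQ (k + 2) τ =
        (2 * (k : ℝ) + 3) * τ * legendreQ (k + 1) τ - ((k : ℝ) + 1) * legendreQ k τ := by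
      rw [legendreQ]
      field_simp
    apply mul_left_cancel₀ hk
    rw [e2, h0, h1]
    linear_combination 2 * e3 - Real.log ((1 + τ) / (1 - τ)) * legendreP_rec k τ

theorem abs_mul_legendreSlope_le (α : ℕ → ℝ) {τ : ℝ} (hτ : τ ∈ Icc (-1 : ℝ) 1) (k : ℕ) {s : ℝ}
    (hs : s ∈ Icc (-1 : ℝ) 1) : |α k * legendreSlope τ k s| ≤ |α k| * 9 ^ k := by
  rw [abs_mul]
  gcongr
  exact abs_legendreSlope_le (abs_le.mpr hτ) k (abs_le.mpr hs)

theorem hasSum_legendreSlope {α : ℕ → ℝ} (hα : Summable fun k => |α k| * 9 ^ k) {τ : ℝ}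
    (hτ : τ ∈ Icc (-1 : ℝ) 1) {s : ℝ} (hs : s ∈ Icc (-1 : ℝ) 1) :
    HasSum (fun k => α k * legendreSlope τ k s) (∑' k, α k * legendreSlope τ k s) :=
  (Summable.of_norm_bounded hα fun k => abs_mul_legendreSlope_le α hτ k hs).hasSum

theorem continuousOn_tsum_legendreSlope {α : ℕ → ℝ} (hα : Summable fun k => |α k| * 9 ^ k) {τ : ℝ}
    (hτ : τ ∈ Icc (-1 : ℝ) 1) :
    ContinuousOn (fun s => ∑' k, α k * legendreSlope τ k s) (Icc (-1) 1) :=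
  continuousOn_tsum (fun k => Continuous.continuousOn (by fun_prop)) hα
    fun k _ hs => abs_mul_legendreSlope_le α hτ k hs

theorem hasSum_integral_legendreSlope {α : ℕ → ℝ} (hα : Summable fun k => |α k| * 9 ^ k) {τ : ℝ}
    (hτ : τ ∈ Icc (-1 : ℝ) 1) :
    HasSum (fun k => α k * (legendreP k τ * Real.log ((1 + τ) / (1 - τ)) - 2 * legendreQ k τ))
      (∫ s in (-1 : ℝ)..1, ∑' k, α k * legendreSlope τ k s) := by
  simp_rw [← integral_legendreSlope, ← intervalIntegral.integral_const_mul]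
  simp_rw [intervalIntegral_eq_mu]
  refine hasSum_integral_of_dominated_convergence (fun k _ => |α k| * 9 ^ k)
    (fun k => Continuous.aestronglyMeasurable (by fun_prop)) (fun k => ?_) ?_ ?_ ?_
  · filter_upwards [ae_restrict_mem measurableSet_Icc] with s hs
    exact abs_mul_legendreSlope_le α hτ k hs
  · filter_upwards with s
    exact hα
  · exact integrable_const _
  · filter_upwards [ae_restrict_mem measurableSet_Icc] with s hs
    exact hasSum_legendreSlope hα hτ hs

/-- The transform `∑ α_k P_k ↦ ∑ α_k Q_k` evaluated at a point `τ`. -/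
theorem hasSum_legendreQ {α : ℕ → ℝ} (hα : Summable fun k => |α k| * 9 ^ k) {τ : ℝ}
    (hτ : τ ∈ Icc (-1 : ℝ) 1) :
    HasSum (fun k => α k * legendreQ k τ)
      (((∑' k, α k * legendreP k τ) * Real.log ((1 + τ) / (1 - τ)) -
        ∫ s in (-1 : ℝ)..1, ∑' k, α k * legendreSlope τ k s) / 2) := by
  -- Solving Neumann's formula for `Q_k` writes the series as a difference of two convergent ones,
  -- with no estimate of `Q_k`.
  have e : ∀ k, α k * legendreQ k τ =
      (α k * legendreP k τ * Real.log ((1 + τ) / (1 - τ)) -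
        α k * (legendreP k τ * Real.log ((1 + τ) / (1 - τ)) - 2 * legendreQ k τ)) / 2 :=
    fun k => by ring
  simp_rw [e]
  exact (((hasSum_legendreP hα hτ).mul_right _).sub
    (hasSum_integral_legendreSlope hα hτ)).div_const 2

end PSWF

end

/-! ### The quadrature weights -/

theorem mainTheorem6 (c : ℝ) (hc : 0 < c) (n : ℕ) (ψ : ℝ → ℝ) (hψ : PSWF.IsPSWF c n ψ) :
    (∀ x ∈ Set.Ioo (-1 : ℝ) 1,
      Summable fun k : ℕ => PSWF.legendreCoeff ψ k * PSWF.legendreQ k x) ∧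
    ∀ t W : Fin n → ℝ, PSWF.IsQuadratureRule n ψ t W → ∀ j : Fin n,
      DifferentiableAt ℝ ψ (t j) ∧
      IntervalIntegrable (PSWF.cardinalFun ψ (t j)) MeasureTheory.volume (-1) 1 ∧
      W j = -(2 / deriv ψ (t j)) *
        ∑' k : ℕ, PSWF.legendreCoeff ψ k * PSWF.legendreQ k (t j) ∧
      W j = -2 * (PSWF.tildePhi ψ (t j) / deriv ψ (t j)) := by
  obtain ⟨a, ha, hsum⟩ := hψ.exists_hasSum hc.ne'
  have hα := PSWF.summable_legendreCoeff ha hsum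
  refine ⟨fun x hx => (PSWF.hasSum_legendreQ hα (Ioo_subset_Icc_self hx)).summable,
    fun t W hW j => ?_⟩
  obtain ⟨hj, hj0⟩ : t j ∈ Ioo (-1 : ℝ) 1 ∧ ψ (t j) = 0 := by
    have : t j ∈ Set.range t := ⟨j, rfl⟩
    rwa [hW.nodes] at this
  have hWj := hW.weights j
  generalize t j = τ at hj hj0 hWj ⊢
  have hτ := Ioo_subset_Icc_self hj
  have hP : ∀ x ∈ Icc (-1 : ℝ) 1, ∑' k, PSWF.legendreCoeff ψ k * PSWF.legendreP k x = ψ x :=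
    fun x hx => (PSWF.hasSum_legendreCoeff_mul_legendreP ha hsum hx).tsum_eq
  have hQ := (PSWF.hasSum_legendreQ hα hτ).tsum_eq
  rw [hP τ hτ, hj0, zero_mul, zero_sub] at hQ
  have hcont := PSWF.continuousOn_tsum_legendreSlope hα hτ
  have hfac : ∀ s ∈ Icc (-1 : ℝ) 1,
      ψ s = (s - τ) * ∑' k, PSWF.legendreCoeff ψ k * PSWF.legendreSlope τ k s := fun s hs => by
    have h1 := (PSWF.hasSum_legendreSlope hα hτ hs).mul_left (s - τ)
    have h2 := (PSWF.hasSum_legendreP hα hs).sub (PSWF.hasSum_legendreP hα hτ)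
    rw [hP s hs, hP τ hτ, hj0, sub_zero] at h2
    refine h2.unique ?_
    simp_rw [← mul_sub, ← PSWF.sub_mul_legendreSlope, mul_left_comm _ (s - τ)]
    exact h1
  set q : ℝ → ℝ := fun s => ∑' k, PSWF.legendreCoeff ψ k * PSWF.legendreSlope τ k s with hq
  -- The difference quotient of `ψ` at its root `τ` is `q` near `τ`, as `τ` is interior to `[-1,
  -- 1]`; continuity of `q` gives the limit.
  have hd : DifferentiableAt ℝ ψ τ := by
    refine HasDerivAt.differentiableAt (f' := q τ) (hasDerivAt_iff_tendsto_slope.mpr ?_)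
    have hc' : Filter.Tendsto q (nhdsWithin τ {τ}ᶜ) (nhds (q τ)) :=
      (hcont.continuousAt (Icc_mem_nhds hj.1 hj.2)).tendsto.mono_left nhdsWithin_le_nhds
    refine hc'.congr' ?_
    filter_upwards [self_mem_nhdsWithin, nhdsWithin_le_nhds (Icc_mem_nhds hj.1 hj.2)] with s hs hs'
    rw [slope_def_field, hj0, sub_zero, hfac s hs', mul_div_cancel_left₀ _ (sub_ne_zero.mpr hs)]
  -- Only `s - τ` is cancelled, off the null set `{τ}`, so simplicity of the root is not needed: if
  -- `ψ'(τ) = 0`, both sides are `0` by the convention for division.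
  have hae : ∀ᵐ s ∂PSWF.mu, q s / deriv ψ τ = PSWF.cardinalFun ψ τ s := by
    filter_upwards [ae_restrict_mem measurableSet_Icc,
      compl_mem_ae_iff.mpr (measure_singleton (μ := PSWF.mu) τ)] with s hs hne
    rw [PSWF.cardinalFun, hfac s hs, mul_comm (deriv ψ τ),
      mul_div_mul_left _ _ (sub_ne_zero.mpr hne)]
  have hqi : Integrable (fun s => q s / deriv ψ τ) PSWF.mu :=
    (PSWF.intervalIntegrable_iff_mu.mp
      (hcont.intervalIntegrable_of_Icc (by norm_num))).div_const _
  have hWq : W j = (∫ s in (-1 : ℝ)..1, q s) / deriv ψ τ := by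
    rw [hWj, PSWF.intervalIntegral_eq_mu, ← integral_congr_ae hae, integral_div,
      PSWF.intervalIntegral_eq_mu]
  refine ⟨hd, PSWF.intervalIntegrable_iff_mu.mpr (hqi.congr hae), ?_, ?_⟩
  · rw [hQ, hWq]
    ring
  · rw [PSWF.tildePhi, hQ, hWq]
    ring
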